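/- For a finite group $G$ let $\mathrm{Z}\ell^1(G)$ be the centre of the complex group algebra $\mathbb{C}G$ with the $\ell^1$-norm $\|f\|=\sum_{g}|f(g)|$, and let $\mathrm{AM}_Z(G)$ be its amenability constant, that is, the norm in the projective tensor product $\mathrm{Z}\ell^1(G)\mathbin{\widehat\otimes}\mathrm{Z}\ell^1(G)$ of the unique element $M$ satisfying $a\cdot M=M\cdot a$ for all $a\in \mathrm{Z}\ell^1(G)$ and $\pi(M)=1$, where $\pi$ is the product map. For a finite field $\mathbb{F}_q$ with $q$ elements let $\mathrm{Aff}(\mathbb{F}_q)$ be the group of matrices $\begin{pmatrix} a&b\\0&1\end{pmatrix}$ with $a\in\mathbb{F}_q^\times$, $b\in\mathbb{F}_q$, and write $\mathrm{Aff}(p)=\mathrm{Aff}(\mathbb{F}_p)$ for $p$ prime. 1. If $q\ge 3$ then $\mathrm{AM}_Z(\mathrm{Aff}(\mathbb{F}_q)) = 5-\frac{8}{q}$. 2. For every odd prime $p$, $2\le \mathrm{AM}_Z(\mathrm{Aff}(p))\le 5$, and $\mathrm{Aff}(p)$ has an irreducible complex character of degree $p-1$. 3. There is a sequence $(G_i)$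 of finite non-abelian groups such that the maximal degrees of irreducible complex characters of the $G_i$ are unbounded, while $\sup_i \mathrm{AM}_Z(G_i)=5$. 4. There is no non-decreasing function $f:\mathbb{N}\to\mathbb{R}$ with $f(n)\to\infty$ as $n\to\infty$ such that $\mathrm{AM}_Z(G)\ge f\bigl(\max\{d_\chi:\chi\in\mathrm{Irr}(G)\}\bigr)$ for all finite non-abelian groups $G$, where $\mathrm{Irr}(G)$ is the set of irreducible complex characters of $G$ and $d_\chi=\chi(1)$. -/

import Mathlib

open scoped TensorProduct

noncomputable section

/-- The projective tensor norm on `A ⊗ A`, where `A` carries the norm `N`: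
the infimum of `∑ N (aᵢ) N (bᵢ)` over all representations `u = ∑ aᵢ ⊗ bᵢ`. -/
def projTensorNorm {A : Type*} [Ring A] [Algebra ℂ A] (N : A → ℝ) (u : A ⊗[ℂ] A) : ℝ :=
  sInf {c : ℝ | ∃ (n : ℕ) (a b : Fin n → A),
    u = ∑ i, a i ⊗ₜ[ℂ] b i ∧ c = ∑ i, N (a i) * N (b i)}

/-- `M ∈ A ⊗ A` is a diagonal element of the unital algebra `A`: `a · M = M · a` for all `a`, where
`a · (x ⊗ y) = (a x) ⊗ y` and `(x ⊗ y) · a = x ⊗ (y a)`, and the product map `A ⊗ A → A`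
sends `M` to `1`. -/
def IsDiagonalElement {A : Type*} [Ring A] [Algebra ℂ A] (M : A ⊗[ℂ] A) : Prop :=
  (∀ a : A, (a ⊗ₜ[ℂ] (1 : A)) * M = M * ((1 : A) ⊗ₜ[ℂ] a)) ∧ LinearMap.mul' ℂ A M = 1

/-- The amenability constant of a finite-dimensional unital algebra `A` with norm `N`: the infimum
of the projective norms of the diagonal elements of `A`. If `A` is commutative and semisimple,
there is exactly one diagonal element, and this is its norm. -/
def amenabilityConstant (A : Type*) [Ring A] [Algebra ℂ A] (N : A → ℝ) : ℝ :=
  sInf {c : ℝ | ∃ M : A ⊗[ℂ] A, IsDiagonalElement M ∧ c = projTensorNorm N M}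

/-- The `ℓ¹`-norm on the group algebra `ℂG` (for `G` finite, `ℂG` with this norm is `ℓ¹(G)`,
with respect to counting measure). -/
def l1Norm {G : Type*} [Group G] (f : MonoidAlgebra ℂ G) : ℝ :=
  f.coeff.sum fun _ c => ‖c‖

/-- `AM_Z(G)`: the amenability constant of the centre of `ℓ¹(G)`, with the `ℓ¹`-norm, for a finite
group `G`. -/
def AMZ (G : Type*) [Group G] [Finite G] : ℝ :=
  amenabilityConstant (Subalgebra.center ℂ (MonoidAlgebra ℂ G))
    (fun z => l1Norm (z : MonoidAlgebra ℂ G))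

/-- The affine group of `K`: the matrices `(a b; 0 1)` with `a` a unit of `K` and `b ∈ K`,
as a subgroup of `GL₂(K)`. -/
def Aff (K : Type*) [CommRing K] : Subgroup (GL (Fin 2) K) where
  carrier := {g | ∃ (a : Kˣ) (b : K), (g : Matrix (Fin 2) (Fin 2) K) = !![(a : K), b; 0, 1]}
  one_mem' := ⟨1, 0, by simp [Matrix.one_fin_two]⟩
  mul_mem' := by
    rintro g h ⟨a, b, hg⟩ ⟨c, d, hh⟩
    exact ⟨a * c, a * d + b, by simp [hg, hh]⟩
  inv_mem' := by
    rintro g ⟨a, b, hg⟩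
    refine ⟨a⁻¹, -(((a⁻¹ : Kˣ) : K) * b), ?_⟩
    rw [Matrix.coe_units_inv, hg]
    apply Matrix.inv_eq_right_inv
    simp [Matrix.one_fin_two]

/-- The set `Irr(G)` of (complex) irreducible characters of a finite group `G`. -/
def irrChars (G : Type*) [Group G] : Set (G → ℂ) :=
  {χ | ∃ (n : ℕ) (ρ : Representation ℂ G (Fin n → ℂ)), ρ.IsIrreducible ∧ χ = ρ.character}

/-- The set of degrees `d_χ = χ(1)` of the irreducible characters of `G`. -/
def charDegrees (G : Type*) [Group G] : Set ℕ :=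
  {d | ∃ χ ∈ irrChars G, χ 1 = (d : ℂ)}

/-- The maximal degree of an irreducible character of a finite group `G`. -/
def maxCharDegree (G : Type*) [Group G] [Finite G] : ℕ :=
  sSup (charDegrees G)

end

/-!
Let `π` be the homomorphism from `Aff F` to the units of `F` taking the linear part. The conjugacy
classes other than `{1}` are the fibres of `π` with `1` removed, so the centre of the group algebra
is spanned by `1` and the averages of the fibres, which multiply like the units. This gives the
diagonal explicitly. Its projective norm is computed by duality: the functional
`f ↦ ∑ g ≠ 1, f g - f 1` has norm one for the `ℓ¹`-norm, and the diagonal is a nonnegative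
combination of tensors `x ⊗ₜ y` at whose factors the functional attains the norm. Evaluating the
square of the functional at the diagonal gives `5 - 8 / q`, which stays below `5`, while the
Kirillov representation of `Aff F` is irreducible of dimension `q - 1`.
-/

section ProjTensorNorm

variable {A : Type*} [Ring A] [Algebra ℂ A] {N : A → ℝ} {Φ : A ⊗[ℂ] A →ₗ[ℂ] ℂ} {φ ψ : A →ₗ[ℂ] ℂ}
  {u v : A ⊗[ℂ] A}

theorem projTensorNorm_sum_tmul_le (hN : ∀ x, 0 ≤ N x) {n : ℕ} (a b : Fin n → A) :
    projTensorNorm N (∑ i, a i ⊗ₜ[ℂ] b i) ≤ ∑ i, N (a i) * N (b i) := by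
  refine csInf_le ⟨0, ?_⟩ ⟨n, a, b, rfl, rfl⟩
  rintro _ ⟨n, a, b, -, rfl⟩
  exact Finset.sum_nonneg fun i _ ↦ mul_nonneg (hN _) (hN _)

theorem projTensorNorm_tmul_le (hN : ∀ x, 0 ≤ N x) (x y : A) :
    projTensorNorm N (x ⊗ₜ[ℂ] y) ≤ N x * N y := by
  simpa using projTensorNorm_sum_tmul_le hN (n := 1) (fun _ ↦ x) (fun _ ↦ y)

theorem le_projTensorNorm {r : ℝ} (h : ∀ (n : ℕ) (a b : Fin n → A),
    u = ∑ i, a i ⊗ₜ[ℂ] b i → r ≤ ∑ i, N (a i) * N (b i)) : r ≤ projTensorNorm N u := by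
  obtain ⟨n, a, b, hu⟩ := TensorProduct.exists_sum_tmul_eq u
  refine le_csInf ⟨_, n, a, b, hu, rfl⟩ ?_
  rintro _ ⟨n, a, b, hu, rfl⟩
  exact h n a b hu

theorem projTensorNorm_add_le (hN : ∀ x, 0 ≤ N x) (u v : A ⊗[ℂ] A) :
    projTensorNorm N (u + v) ≤ projTensorNorm N u + projTensorNorm N v := by
  rw [← sub_le_iff_le_add]
  refine le_projTensorNorm fun m a b hu ↦ ?_
  rw [sub_le_iff_le_add, ← sub_le_iff_le_add']
  refine le_projTensorNorm fun n c d hv ↦ ?_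
  have huv : u + v = ∑ i, Fin.append a c i ⊗ₜ[ℂ] Fin.append b d i := by
    simp [Fin.sum_univ_add, hu, hv]
  rw [sub_le_iff_le_add', huv]
  simpa [Fin.sum_univ_add] using
    projTensorNorm_sum_tmul_le hN (Fin.append a c) (Fin.append b d)

theorem projTensorNorm_smul_le (hN : ∀ x, 0 ≤ N x) (hsmul : ∀ (c : ℂ) x, N (c • x) = ‖c‖ * N x)
    {c : ℂ} (hc : c ≠ 0) (u : A ⊗[ℂ] A) :
    projTensorNorm N (c • u) ≤ ‖c‖ * projTensorNorm N u := by
  rw [← div_le_iff₀' (norm_pos_iff.mpr hc)]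
  refine le_projTensorNorm fun n a b hu ↦ ?_
  rw [div_le_iff₀' (norm_pos_iff.mpr hc), hu, Finset.smul_sum, Finset.mul_sum]
  simpa only [TensorProduct.smul_tmul', hsmul, mul_assoc] using
    projTensorNorm_sum_tmul_le hN (fun i ↦ c • a i) b

theorem norm_le_projTensorNorm (hΦ : ∀ x y, ‖Φ (x ⊗ₜ y)‖ ≤ N x * N y) (u : A ⊗[ℂ] A) :
    ‖Φ u‖ ≤ projTensorNorm N u := by
  refine le_projTensorNorm fun n a b hu ↦ ?_
  rw [hu, map_sum]
  exact norm_sum_le_of_le _ fun i _ ↦ hΦ (a i) (b i)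

theorem norm_dualDistrib_tmul_le (hφ : ∀ x, ‖φ x‖ ≤ N x) (hψ : ∀ x, ‖ψ x‖ ≤ N x) (x y : A) :
    ‖TensorProduct.dualDistrib ℂ A A (φ ⊗ₜ ψ) (x ⊗ₜ y)‖ ≤ N x * N y := by
  rw [TensorProduct.dualDistrib_apply, norm_mul]
  exact mul_le_mul (hφ x) (hψ y) (norm_nonneg _) ((norm_nonneg _).trans (hφ x))

/-- The functional `Φ` norms `u`: it takes the value `‖u‖` at `u`, for the projective norm
induced by `N`. When `Φ` has norm at most one, the tensors it norms form a convex cone. -/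
def NormsTensor (N : A → ℝ) (Φ : A ⊗[ℂ] A →ₗ[ℂ] ℂ) (u : A ⊗[ℂ] A) : Prop :=
  Φ u = (projTensorNorm N u : ℂ)

namespace NormsTensor

theorem of_projTensorNorm_le (hΦ : ∀ x y, ‖Φ (x ⊗ₜ y)‖ ≤ N x * N y) {r : ℝ}
    (hle : projTensorNorm N u ≤ r) (hu : Φ u = r) : NormsTensor N Φ u := by
  have hr : r ≤ projTensorNorm N u := calc
    r ≤ ‖(r : ℂ)‖ := by rw [Complex.norm_real]; exact le_abs_self r
    _ = ‖Φ u‖ := by rw [hu]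
    _ ≤ projTensorNorm N u := norm_le_projTensorNorm hΦ u
  rw [NormsTensor, hu, hle.antisymm hr]

theorem dualDistrib_tmul (hφ : ∀ x, ‖φ x‖ ≤ N x) (hψ : ∀ x, ‖ψ x‖ ≤ N x) {x y : A}
    (hx : φ x = N x) (hy : ψ y = N y) :
    NormsTensor N (TensorProduct.dualDistrib ℂ A A (φ ⊗ₜ ψ)) (x ⊗ₜ y) :=
  of_projTensorNorm_le (norm_dualDistrib_tmul_le hφ hψ)
    (projTensorNorm_tmul_le (fun x ↦ (norm_nonneg _).trans (hφ x)) x y) <| by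
      rw [TensorProduct.dualDistrib_apply, hx, hy, Complex.ofReal_mul]

variable (hN : ∀ x, 0 ≤ N x) (hΦ : ∀ x y, ‖Φ (x ⊗ₜ y)‖ ≤ N x * N y)
include hN hΦ

theorem add (hu : NormsTensor N Φ u) (hv : NormsTensor N Φ v) : NormsTensor N Φ (u + v) :=
  of_projTensorNorm_le hΦ (projTensorNorm_add_le hN u v) <| by
    rw [map_add, hu, hv, Complex.ofReal_add]

theorem zero : NormsTensor N Φ 0 :=
  of_projTensorNorm_le hΦ (by simpa using projTensorNorm_sum_tmul_le hN (n := 0) 0 0) <| by simp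

theorem sum {ι : Type*} {s : Finset ι} {f : ι → A ⊗[ℂ] A}
    (hf : ∀ i ∈ s, NormsTensor N Φ (f i)) : NormsTensor N Φ (∑ i ∈ s, f i) :=
  Finset.sum_induction f _ (fun _ _ ↦ add hN hΦ) (zero hN hΦ) hf

theorem smul (hsmul : ∀ (c : ℂ) x, N (c • x) = ‖c‖ * N x) (hu : NormsTensor N Φ u) {r : ℝ}
    (hr : 0 ≤ r) : NormsTensor N Φ ((r : ℂ) • u) := by
  obtain rfl | hr := hr.eq_or_lt
  · simpa using zero hN hΦ
  · have hle := projTensorNorm_smul_le hN hsmul (Complex.ofReal_ne_zero.mpr hr.ne') u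
    rw [Complex.norm_of_nonneg hr.le] at hle
    exact of_projTensorNorm_le hΦ hle <| by rw [map_smul, hu, smul_eq_mul, Complex.ofReal_mul]

end NormsTensor

end ProjTensorNorm

section Diagonal

variable {A H : Type*} [Ring A] [Algebra ℂ A]

open scoped IsMulCommutative in
theorem IsDiagonalElement.mul_eq [IsMulCommutative A] {M : A ⊗[ℂ] A} (hM : IsDiagonalElement M)
    (u : A ⊗[ℂ] A) : M * u = M * (1 ⊗ₜ[ℂ] LinearMap.mul' ℂ A u) := by
  induction u with
  | zero => simp
  | add x y hx hy => rw [mul_add, hx, hy, map_add, TensorProduct.tmul_add, mul_add]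
  | tmul a b => calc
      M * (a ⊗ₜ[ℂ] b) = (a ⊗ₜ[ℂ] 1) * M * (1 ⊗ₜ[ℂ] b) := by
        rw [mul_right_comm, Algebra.TensorProduct.tmul_mul_tmul, mul_one, one_mul, mul_comm]
      _ = M * (1 ⊗ₜ[ℂ] LinearMap.mul' ℂ A (a ⊗ₜ[ℂ] b)) := by
        rw [hM.1, mul_assoc, Algebra.TensorProduct.tmul_mul_tmul, one_mul, LinearMap.mul'_apply]

open scoped IsMulCommutative in
theorem IsDiagonalElement.unique [IsMulCommutative A] {M M' : A ⊗[ℂ] A}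
    (hM : IsDiagonalElement M) (hM' : IsDiagonalElement M') : M = M' := calc
  M = M * M' := by rw [hM.mul_eq, hM'.2, ← Algebra.TensorProduct.one_def, mul_one]
  _ = M' := by rw [mul_comm, hM'.mul_eq, hM.2, ← Algebra.TensorProduct.one_def, mul_one]

theorem IsDiagonalElement.amenabilityConstant_eq [IsMulCommutative A] {M : A ⊗[ℂ] A}
    (hM : IsDiagonalElement M) (N : A → ℝ) : amenabilityConstant A N = projTensorNorm N M := by
  have hset : {c : ℝ | ∃ M' : A ⊗[ℂ] A, IsDiagonalElement M' ∧ c = projTensorNorm N M'} =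
      {projTensorNorm N M} :=
    Set.eq_singleton_iff_unique_mem.mpr
      ⟨⟨M, hM, rfl⟩, fun c ⟨M', hM', hc⟩ ↦ by rw [hc, hM'.unique hM]⟩
  rw [amenabilityConstant, hset, csInf_singleton]

variable [Group H] [Fintype H]

/-- The diagonal element of the algebra spanned by `1` and the image of a multiplicative map
`e : H → A` which need not be unital: the algebra is the product of its ideals generated by the
idempotents `1 - e 1` and `e 1`, the latter being a quotient of the group algebra of `H`. -/
noncomputable def groupDiagonal (e : H → A) : A ⊗[ℂ] A :=
  (1 - e 1) ⊗ₜ[ℂ] (1 - e 1) + (Nat.card H : ℂ)⁻¹ • ∑ a, e a ⊗ₜ[ℂ] e a⁻¹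

theorem tmul_one_mul_groupDiagonal (e : H →ₙ* A) (b : H) :
    (e b ⊗ₜ[ℂ] 1) * groupDiagonal e = groupDiagonal e * (1 ⊗ₜ[ℂ] e b) := by
  have hleft : e b * (1 - e 1) = 0 := by rw [mul_sub, ← map_mul, mul_one, mul_one, sub_self]
  have hright : (1 - e 1) * e b = 0 := by rw [sub_mul, ← map_mul, one_mul, one_mul, sub_self]
  have hshift : ∑ a, e (b * a) ⊗ₜ[ℂ] e a⁻¹ = ∑ a, e a ⊗ₜ[ℂ] e (a⁻¹ * b) :=
    Fintype.sum_equiv (Equiv.mulLeft b) _ _ fun a ↦ by simp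
  simp only [groupDiagonal, mul_add, add_mul, mul_smul_comm, smul_mul_assoc, Finset.mul_sum,
    Finset.sum_mul, Algebra.TensorProduct.tmul_mul_tmul, one_mul, mul_one, hleft, hright,
    TensorProduct.zero_tmul, TensorProduct.tmul_zero, ← map_mul, hshift]

theorem mul'_groupDiagonal (e : H →ₙ* A) : LinearMap.mul' ℂ A (groupDiagonal e) = 1 := by
  have hidem : IsIdempotentElem (1 - e 1) :=
    IsIdempotentElem.one_sub (by rw [IsIdempotentElem, ← map_mul, mul_one])
  have hcard : (Nat.card H : ℂ) ≠ 0 := Nat.cast_ne_zero.mpr Nat.card_pos.ne'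
  simp only [groupDiagonal, map_add, map_smul, map_sum, LinearMap.mul'_apply, hidem.eq,
    ← map_mul, mul_inv_cancel, Finset.sum_const, Finset.card_univ, ← Nat.card_eq_fintype_card]
  rw [← Nat.cast_smul_eq_nsmul ℂ, inv_smul_smul₀ hcard, sub_add_cancel]

theorem isDiagonalElement_groupDiagonal (e : H →ₙ* A)
    (he : Submodule.span ℂ (insert 1 (Set.range e)) = ⊤) :
    IsDiagonalElement (groupDiagonal e) := by
  refine ⟨fun a ↦ ?_, mul'_groupDiagonal e⟩
  have ha : a ∈ Submodule.span ℂ (insert 1 (Set.range e)) := he ▸ Submodule.mem_top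
  induction ha using Submodule.span_induction with
  | mem x hx =>
    obtain rfl | ⟨b, rfl⟩ := hx
    · rw [← Algebra.TensorProduct.one_def, one_mul, mul_one]
    · exact tmul_one_mul_groupDiagonal e b
  | zero => simp
  | add x y _ _ hx hy =>
    rw [TensorProduct.add_tmul, add_mul, hx, hy, TensorProduct.tmul_add, mul_add]
  | smul c x _ hx =>
    rw [← TensorProduct.smul_tmul', smul_mul_assoc, hx, TensorProduct.tmul_smul, mul_smul_comm]

theorem tmul_self_eq (x : A) {t : ℂ} (ht : t ≠ 0) (ht1 : t - 1 ≠ 0) :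
    x ⊗ₜ[ℂ] x = (t * (t - 1))⁻¹ • (t • x - 1) ⊗ₜ[ℂ] (t • x - 1) + t⁻¹ • (-1) ⊗ₜ[ℂ] (-1) -
      (t - 1)⁻¹ • (x - 1) ⊗ₜ[ℂ] (x - 1) := by
  simp only [TensorProduct.sub_tmul, TensorProduct.tmul_sub, TensorProduct.neg_tmul,
    TensorProduct.tmul_neg, ← TensorProduct.smul_tmul', TensorProduct.tmul_smul]
  match_scalars <;> field_simp <;> ring

/-- The summand `e 1 ⊗ₜ e 1` of `groupDiagonal e` is traded for squares of `-1`, `e 1 - 1` and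
`t • e 1 - 1`. When `e 1` is the average of a subgroup of order `t`, it has the wrong sign at `1`,
whereas these three elements are nonpositive at `1` and nonnegative elsewhere. The coefficients of
the squares are nonnegative for `2 ≤ t`. -/
theorem groupDiagonal_eq_add [DecidableEq H] (e : H → A) {t : ℂ} (ht : t ≠ 0) (ht1 : t - 1 ≠ 0) :
    groupDiagonal e =
      (1 - ((Nat.card H : ℂ) * (t - 1))⁻¹) • (e 1 - 1) ⊗ₜ[ℂ] (e 1 - 1) +
      ((Nat.card H : ℂ) * t)⁻¹ • (-1) ⊗ₜ[ℂ] (-1) +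
      ((Nat.card H : ℂ) * (t * (t - 1)))⁻¹ • (t • e 1 - 1) ⊗ₜ[ℂ] (t • e 1 - 1) +
      (Nat.card H : ℂ)⁻¹ • ∑ a ∈ Finset.univ.erase 1, e a ⊗ₜ[ℂ] e a⁻¹ := by
  have hsub : (1 - e 1) ⊗ₜ[ℂ] (1 - e 1) = (e 1 - 1) ⊗ₜ[ℂ] (e 1 - 1) := by
    rw [← neg_sub, TensorProduct.neg_tmul, TensorProduct.tmul_neg, neg_neg]
  rw [groupDiagonal, ← Finset.add_sum_erase _ _ (Finset.mem_univ 1), inv_one, hsub,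
    tmul_self_eq (e 1) ht ht1]
  simp only [mul_inv]
  module

theorem normsTensor_groupDiagonal (e : H → A) {N : A → ℝ} {φ : A →ₗ[ℂ] ℂ} {t : ℝ} (ht : 2 ≤ t)
    (hsmul : ∀ (c : ℂ) x, N (c • x) = ‖c‖ * N x) (hφ : ∀ x, ‖φ x‖ ≤ N x)
    (hone : ∀ s ∈ Set.Icc 0 t, φ ((s : ℂ) • e 1 - 1) = N ((s : ℂ) • e 1 - 1))
    (hne : ∀ a ≠ 1, φ (e a) = N (e a)) :
    NormsTensor N (TensorProduct.dualDistrib ℂ A A (φ ⊗ₜ φ)) (groupDiagonal e) := by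
  classical
  have hN (x) : 0 ≤ N x := (norm_nonneg _).trans (hφ x)
  have hΦ := norm_dualDistrib_tmul_le hφ hφ
  have hcard : (1 : ℝ) ≤ Nat.card H := Nat.one_le_cast.mpr Nat.card_pos
  have hcoeff : 0 ≤ 1 - ((Nat.card H : ℝ) * (t - 1))⁻¹ :=
    sub_nonneg.mpr <| inv_le_one_of_one_le₀ <| one_le_mul_of_one_le_of_one_le hcard (by linarith)
  have ht0 : 0 < t := by linarith
  have ht1 : 0 < t - 1 := by linarith
  have hzero : φ (-1) = N (-1) := by simpa using hone 0 ⟨le_rfl, ht0.le⟩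
  have hsub : φ (e 1 - 1) = N (e 1 - 1) := by simpa using hone 1 ⟨zero_le_one, by linarith⟩
  have hsmul_sub := hone t ⟨ht0.le, le_rfl⟩
  have hsum := NormsTensor.sum hN hΦ (s := Finset.univ.erase 1) (f := fun a ↦ e a ⊗ₜ[ℂ] e a⁻¹)
    fun a ha ↦ .dualDistrib_tmul hφ hφ (hne a (Finset.ne_of_mem_erase ha))
      (hne a⁻¹ (inv_ne_one.mpr (Finset.ne_of_mem_erase ha)))
  rw [groupDiagonal_eq_add e (Complex.ofReal_ne_zero.mpr ht0.ne')
    (mod_cast Complex.ofReal_ne_zero.mpr ht1.ne')]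
  refine .add hN hΦ (.add hN hΦ (.add hN hΦ ?_ ?_) ?_) ?_
  · exact_mod_cast (NormsTensor.dualDistrib_tmul hφ hφ hsub hsub).smul hN hΦ hsmul hcoeff
  · exact_mod_cast (NormsTensor.dualDistrib_tmul hφ hφ hzero hzero).smul hN hΦ hsmul
      (r := ((Nat.card H : ℝ) * t)⁻¹) (by positivity)
  · exact_mod_cast (NormsTensor.dualDistrib_tmul hφ hφ hsmul_sub hsmul_sub).smul hN hΦ hsmul
      (r := ((Nat.card H : ℝ) * (t * (t - 1)))⁻¹) (by positivity)
  · rw [← Complex.ofReal_natCast, ← Complex.ofReal_inv]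
    exact hsum.smul hN hΦ hsmul (by positivity)

theorem dualDistrib_groupDiagonal (e : H → A) (φ : A →ₗ[ℂ] ℂ) :
    TensorProduct.dualDistrib ℂ A A (φ ⊗ₜ φ) (groupDiagonal e) =
      φ (1 - e 1) ^ 2 + (Nat.card H : ℂ)⁻¹ * ∑ a, φ (e a) * φ (e a⁻¹) := by
  simp only [groupDiagonal, map_add, map_smul, map_sum, TensorProduct.dualDistrib_apply,
    smul_eq_mul, sq]

theorem amenabilityConstant_eq_of_mulHom [IsMulCommutative A] (e : H →ₙ* A)
    (he : Submodule.span ℂ (insert 1 (Set.range e)) = ⊤) {N : A → ℝ} {φ : A →ₗ[ℂ] ℂ} {t : ℝ}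
    (ht : 2 ≤ t) (hsmul : ∀ (c : ℂ) x, N (c • x) = ‖c‖ * N x) (hφ : ∀ x, ‖φ x‖ ≤ N x)
    (hone : ∀ s ∈ Set.Icc 0 t, φ ((s : ℂ) • e 1 - 1) = N ((s : ℂ) • e 1 - 1))
    (hne : ∀ a ≠ 1, φ (e a) = N (e a)) :
    (amenabilityConstant A N : ℂ) =
      φ (1 - e 1) ^ 2 + (Nat.card H : ℂ)⁻¹ * ∑ a, φ (e a) * φ (e a⁻¹) := by
  rw [(isDiagonalElement_groupDiagonal e he).amenabilityConstant_eq,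
    ← normsTensor_groupDiagonal e ht hsmul hφ hone hne, dualDistrib_groupDiagonal]

end Diagonal

section L1Norm

variable {G : Type*} [Group G] {ε : G → ℂ}

theorem l1Norm_smul (c : ℂ) (f : MonoidAlgebra ℂ G) : l1Norm (c • f) = ‖c‖ * l1Norm f := by
  rw [l1Norm, l1Norm, MonoidAlgebra.coeff_smul, Finsupp.sum_smul_index' (by simp), Finsupp.mul_sum]
  simp only [smul_eq_mul, norm_mul]

/-- The pairing of the group algebra with a function on the group, bounded for the `ℓ¹`-norm when
the function is: this is the duality between `ℓ¹` and `ℓ^∞`. -/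
noncomputable def l1Pairing (ε : G → ℂ) : MonoidAlgebra ℂ G →ₗ[ℂ] ℂ :=
  Finsupp.linearCombination ℂ ε ∘ₗ (MonoidAlgebra.coeffLinearEquiv ℂ).toLinearMap

theorem norm_l1Pairing_le (hε : ∀ g, ‖ε g‖ ≤ 1) (f : MonoidAlgebra ℂ G) :
    ‖l1Pairing ε f‖ ≤ l1Norm f :=
  norm_sum_le_of_le _ fun g _ ↦
    (norm_mul_le _ _).trans (mul_le_of_le_one_right (norm_nonneg _) (hε g))

theorem l1Pairing_eq_l1Norm {f : MonoidAlgebra ℂ G} (hf : ∀ g, f.coeff g * ε g = ‖f.coeff g‖) :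
    l1Pairing ε f = l1Norm f :=
  (Finset.sum_congr rfl fun g _ ↦ hf g).trans (Complex.ofReal_sum _ _).symm

open Classical in
/-- The functional `f ↦ ∑ g ≠ 1, f g - f 1` on the group algebra. It norms, for the `ℓ¹`-norm,
the elements with nonnegative coefficients away from `1` and a nonpositive coefficient at `1`. -/
noncomputable def signedAugmentation (G : Type*) [Group G] : MonoidAlgebra ℂ G →ₗ[ℂ] ℂ :=
  l1Pairing fun g ↦ if g = 1 then -1 else 1

theorem norm_signedAugmentation_le (f : MonoidAlgebra ℂ G) :
    ‖signedAugmentation G f‖ ≤ l1Norm f :=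
  norm_l1Pairing_le (fun g ↦ by split_ifs <;> simp) f

open scoped ComplexOrder in
theorem signedAugmentation_eq_l1Norm {f : MonoidAlgebra ℂ G} (hone : f.coeff 1 ≤ 0)
    (hne : ∀ g ≠ 1, 0 ≤ f.coeff g) : signedAugmentation G f = l1Norm f := by
  refine l1Pairing_eq_l1Norm fun g ↦ ?_
  split_ifs with hg
  · rw [hg, mul_neg_one, ← norm_neg]
    exact Complex.eq_coe_norm_of_nonneg (neg_nonneg.mpr hone)
  · rw [mul_one]
    exact Complex.eq_coe_norm_of_nonneg (hne g hg)

theorem signedAugmentation_eq_sum_sub [Fintype G] (f : MonoidAlgebra ℂ G) :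
    signedAugmentation G f = ∑ g, f.coeff g - 2 * f.coeff 1 := by
  classical
  calc
    signedAugmentation G f = ∑ g, f.coeff g * if g = 1 then -1 else 1 :=
      Finsupp.sum_fintype _ _ (by simp)
    _ = ∑ g, (f.coeff g - if g = 1 then 2 * f.coeff g else 0) :=
      Finset.sum_congr rfl fun g _ ↦ by split_ifs <;> ring
    _ = ∑ g, f.coeff g - 2 * f.coeff 1 := by simp

end L1Norm

section FibreAverage

theorem mem_center_monoidAlgebra_iff {k G : Type*} [CommSemiring k] [Group G]
    {x : MonoidAlgebra k G} :
    x ∈ Subalgebra.center k (MonoidAlgebra k G) ↔ ∀ g h, IsConj g h → x.coeff g = x.coeff h := by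
  rw [Subalgebra.mem_center_iff]
  constructor
  · intro hx g h hgh
    obtain ⟨c, rfl⟩ := isConj_iff.mp hgh
    simpa using congr(($(hx (.single c 1))).coeff (c * g))
  · intro hx y
    induction y using MonoidAlgebra.induction_linear with
    | zero => simp
    | add y z hy hz => rw [add_mul, mul_add, hy, hz]
    | single g r =>
      ext h
      have hconj : IsConj (g⁻¹ * h) (h * g⁻¹) := isConj_iff.mpr ⟨g, by group⟩
      simp [hx _ _ hconj, mul_comm r]

variable {k G H : Type*} [Field k] [Group G] [Finite G] [Group H] {π : G →* H}

open Classical in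
/-- The average, in the group algebra, of the elements of the fibre of `π` over `a`. Averages of
fibres multiply like the elements of `H` themselves. -/
noncomputable def fibreAverage (k : Type*) [Field k] (π : G →* H) (a : H) : MonoidAlgebra k G :=
  .ofCoeff <| Finsupp.equivFunOnFinite.symm fun g ↦ if π g = a then (Nat.card π.ker : k)⁻¹ else 0

open Classical in
theorem coeff_fibreAverage (a : H) (g : G) :
    (fibreAverage k π a).coeff g = if π g = a then (Nat.card π.ker : k)⁻¹ else 0 := rfl

theorem sum_coeff_fibreAverage [CharZero k] [Fintype G] (hπ : Function.Surjective π) (a : H) :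
    ∑ g, (fibreAverage k π a).coeff g = 1 := by
  classical
  have hfibre : (Finset.univ.filter fun g ↦ π g = a).card = Nat.card π.ker := by
    rw [← Nat.card_congr (MonoidHom.fiberEquivKerOfSurjective hπ a), ← Fintype.card_subtype,
      Fintype.card_eq_nat_card]
    rfl
  simp only [coeff_fibreAverage, ← Finset.sum_filter, Finset.sum_const, hfibre, nsmul_eq_mul]
  exact mul_inv_cancel₀ (Nat.cast_ne_zero.mpr Nat.card_pos.ne')

theorem fibreAverage_mul_single (a : H) (g : G) (r : k) :
    fibreAverage k π a * .single g r = r • fibreAverage k π (a * π g) := by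
  classical
  ext h
  rw [MonoidAlgebra.coeff_mul_single_apply, MonoidAlgebra.coeff_smul_apply, smul_eq_mul, mul_comm,
    coeff_fibreAverage, coeff_fibreAverage, map_mul, map_inv]
  exact congrArg (r * ·) (if_congr mul_inv_eq_iff_eq_mul rfl rfl)

theorem fibreAverage_mul_fibreAverage [CharZero k] (hπ : Function.Surjective π) (a b : H) :
    fibreAverage k π a * fibreAverage k π b = fibreAverage k π (a * b) := by
  have := Fintype.ofFinite G
  have hterm (g : G) : fibreAverage k π a * .single g ((fibreAverage k π b).coeff g) =
      (fibreAverage k π b).coeff g • fibreAverage k π (a * b) := by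
    rw [fibreAverage_mul_single]
    by_cases hg : π g = b
    · rw [hg]
    · simp [coeff_fibreAverage, hg]
  have hsingle (x : MonoidAlgebra k G) : x = ∑ g, .single g (x.coeff g) := by
    ext h
    simp
  rw [hsingle (fibreAverage k π b), Finset.mul_sum, Finset.sum_congr rfl fun g _ ↦ hterm g,
    ← Finset.sum_smul, sum_coeff_fibreAverage hπ, one_smul]

theorem eq_sum_smul_fibreAverage [CharZero k] [Fintype H] {x : MonoidAlgebra k G} {y : H → k}
    (hx : ∀ g, x.coeff g = y (π g)) :
    x = ∑ a, (Nat.card π.ker * y a) • fibreAverage k π a := by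
  classical
  ext g
  have hcard : (Nat.card π.ker : k) ≠ 0 := Nat.cast_ne_zero.mpr Nat.card_pos.ne'
  simp [-MonoidHom.mem_ker, coeff_fibreAverage, hx, mul_right_comm, hcard]

theorem signedAugmentation_fibreAverage (hπ : Function.Surjective π) (a : H) :
    signedAugmentation G (fibreAverage ℂ π a) = 1 - 2 * (fibreAverage ℂ π a).coeff 1 := by
  have := Fintype.ofFinite G
  rw [signedAugmentation_eq_sum_sub, sum_coeff_fibreAverage hπ]

open scoped ComplexOrder in
theorem coeff_fibreAverage_nonneg (a : H) (g : G) : 0 ≤ (fibreAverage ℂ π a).coeff g := by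
  rw [coeff_fibreAverage]
  split_ifs
  exacts [inv_nonneg.mpr (Nat.cast_nonneg _), le_rfl]

theorem signedAugmentation_fibreAverage_eq_l1Norm {a : H} (ha : a ≠ 1) :
    signedAugmentation G (fibreAverage ℂ π a) = l1Norm (fibreAverage ℂ π a) :=
  signedAugmentation_eq_l1Norm (by simp [coeff_fibreAverage, ha.symm])
    fun g _ ↦ coeff_fibreAverage_nonneg a g

open scoped ComplexOrder in
theorem signedAugmentation_smul_fibreAverage_one_sub_one {s : ℝ}
    (hs : s ∈ Set.Icc (0 : ℝ) (Nat.card π.ker)) :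
    signedAugmentation G ((s : ℂ) • fibreAverage ℂ π 1 - 1) =
      l1Norm ((s : ℂ) • fibreAverage ℂ π 1 - 1) := by
  have hcard : (0 : ℝ) < Nat.card π.ker := Nat.cast_pos.mpr Nat.card_pos
  refine signedAugmentation_eq_l1Norm ?_ fun g hg ↦ ?_
  · have hle : ((s * (Nat.card π.ker : ℝ)⁻¹ - 1 : ℝ) : ℂ) ≤ 0 := by
      rw [← Complex.ofReal_zero, Complex.real_le_real, sub_nonpos, ← div_eq_mul_inv]
      exact div_le_one_of_le₀ hs.2 hcard.le
    simpa [-MonoidHom.mem_ker, coeff_fibreAverage] using hle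
  · simpa [MonoidAlgebra.one_def, hg.symm] using
      mul_nonneg (Complex.zero_le_real.mpr hs.1) (coeff_fibreAverage_nonneg (π := π) 1 g)

end FibreAverage

section CentralFibreAverage

theorem exists_ne_one_map_eq {G H : Type*} [Group G] [Group H] {π : G →* H}
    (hπ : Function.Surjective π) [Nontrivial π.ker] (a : H) :
    ∃ g ≠ 1, π g = a := by
  obtain rfl | ha := eq_or_ne a 1
  · obtain ⟨g, hg⟩ := exists_ne (1 : π.ker)
    exact ⟨g, Subtype.coe_ne_coe.mpr hg, g.2⟩
  · obtain ⟨g, rfl⟩ := hπ a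
    exact ⟨g, fun hg ↦ ha (by rw [hg, map_one]), rfl⟩

variable {k G H : Type*} [Field k] [CharZero k] [Group G] [Finite G] [CommGroup H] {π : G →* H}

/-- The averages of the fibres of `π`, as a multiplicative map to the centre of the group
algebra: when `H` is commutative, the fibres are unions of conjugacy classes. -/
noncomputable def centralFibreAverage (k : Type*) [Field k] [CharZero k]
    (hπ : Function.Surjective π) : H →ₙ* Subalgebra.center k (MonoidAlgebra k G) where
  toFun a := ⟨fibreAverage k π a, mem_center_monoidAlgebra_iff.mpr fun g h hgh ↦ by
    rw [coeff_fibreAverage, coeff_fibreAverage, isConj_iff_eq.mp (π.map_isConj hgh)]⟩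
  map_mul' a b := Subtype.ext (fibreAverage_mul_fibreAverage hπ a b).symm

theorem coe_centralFibreAverage (hπ : Function.Surjective π) (a : H) :
    (centralFibreAverage k hπ a : MonoidAlgebra k G) = fibreAverage k π a := rfl

theorem span_insert_one_range_centralFibreAverage (hπ : Function.Surjective π) [Nontrivial π.ker]
    (hconj : ∀ g h, π g = π h → g ≠ 1 → h ≠ 1 → IsConj g h) :
    Submodule.span k (insert 1 (Set.range (centralFibreAverage k hπ))) = ⊤ := by
  have : Finite H := .of_surjective π hπ
  have := Fintype.ofFinite H
  choose s hs hπs using exists_ne_one_map_eq hπ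
  refine eq_top_iff.mpr fun z _ ↦ ?_
  set c := (z : MonoidAlgebra k G).coeff 1 - (z : MonoidAlgebra k G).coeff (s 1)
  have hcoeff (g : G) : (z - c • 1 : MonoidAlgebra k G).coeff g =
      (z : MonoidAlgebra k G).coeff (s (π g)) := by
    obtain rfl | hg := eq_or_ne g 1
    · simp [c]
    · have hz := mem_center_monoidAlgebra_iff.mp z.2 _ _ (hconj g _ (hπs _).symm hg (hs _))
      simp [MonoidAlgebra.one_def, hg.symm, hz]
  have hsum : z - c • 1 = ∑ a, ((Nat.card π.ker : k) * (z : MonoidAlgebra k G).coeff (s a)) •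
      centralFibreAverage k hπ a := Subtype.ext <| by
    simpa [coe_centralFibreAverage] using eq_sum_smul_fibreAverage hcoeff
  rw [← add_sub_cancel (c • 1) z, hsum]
  exact add_mem (Submodule.smul_mem _ _ (Submodule.subset_span (Set.mem_insert _ _)))
    (sum_mem fun a _ ↦ Submodule.smul_mem _ _ (Submodule.subset_span (by simp)))

/-- The restriction of `signedAugmentation G` to the centre of the group algebra. -/
noncomputable def centralSignedAugmentation (G : Type*) [Group G] :
    Subalgebra.center ℂ (MonoidAlgebra ℂ G) →ₗ[ℂ] ℂ :=
  signedAugmentation G ∘ₗ (Subalgebra.center ℂ (MonoidAlgebra ℂ G)).val.toLinearMap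

omit [Finite G] in
theorem centralSignedAugmentation_apply (z : Subalgebra.center ℂ (MonoidAlgebra ℂ G)) :
    centralSignedAugmentation G z = signedAugmentation G z := rfl

open Classical in
theorem centralSignedAugmentation_centralFibreAverage (hπ : Function.Surjective π) (a : H) :
    centralSignedAugmentation G (centralFibreAverage ℂ hπ a) =
      1 - 2 * if a = 1 then (Nat.card π.ker : ℂ)⁻¹ else 0 := by
  rw [centralSignedAugmentation_apply, coe_centralFibreAverage, signedAugmentation_fibreAverage hπ,
    coeff_fibreAverage, map_one, if_congr eq_comm rfl rfl]

theorem centralSignedAugmentation_one_sub_centralFibreAverage (hπ : Function.Surjective π) :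
    centralSignedAugmentation G (1 - centralFibreAverage ℂ hπ 1) =
      -2 * (1 - (Nat.card π.ker : ℂ)⁻¹) := by
  have := Fintype.ofFinite G
  have hone : centralSignedAugmentation G 1 = -1 := by
    rw [centralSignedAugmentation_apply, signedAugmentation_eq_sum_sub]
    simpa [MonoidAlgebra.one_def] using (by norm_num : (1 : ℂ) - 2 = -1)
  rw [map_sub, hone, centralSignedAugmentation_centralFibreAverage, if_pos rfl]
  ring

theorem ofReal_AMZ_eq_of_isConj [Fintype H] (hπ : Function.Surjective π) [Nontrivial π.ker]
    (hconj : ∀ g h, π g = π h → g ≠ 1 → h ≠ 1 → IsConj g h) :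
    (AMZ G : ℂ) = centralSignedAugmentation G (1 - centralFibreAverage ℂ hπ 1) ^ 2 +
      (Nat.card H : ℂ)⁻¹ * ∑ a, centralSignedAugmentation G (centralFibreAverage ℂ hπ a) *
        centralSignedAugmentation G (centralFibreAverage ℂ hπ a⁻¹) := by
  refine amenabilityConstant_eq_of_mulHom (A := Subalgebra.center ℂ (MonoidAlgebra ℂ G)) _
    (span_insert_one_range_centralFibreAverage hπ hconj) (t := Nat.card π.ker)
    (by exact_mod_cast Finite.one_lt_card (α := π.ker)) (fun c z ↦ ?_) (fun z ↦ ?_)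
    (fun s hs ↦ ?_) (fun a ha ↦ ?_)
  · simp only [Subalgebra.coe_smul, l1Norm_smul]
  · rw [centralSignedAugmentation_apply]
    exact norm_signedAugmentation_le _
  · rw [centralSignedAugmentation_apply]
    exact signedAugmentation_smul_fibreAverage_one_sub_one hs
  · rw [centralSignedAugmentation_apply]
    exact signedAugmentation_fibreAverage_eq_l1Norm ha

theorem AMZ_eq_of_isConj (hπ : Function.Surjective π) [Nontrivial π.ker]
    (hconj : ∀ g h, π g = π h → g ≠ 1 → h ≠ 1 → IsConj g h) :
    AMZ G = 1 + 4 * (1 - (Nat.card π.ker : ℝ)⁻¹) *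
      (1 - (Nat.card π.ker : ℝ)⁻¹ - (Nat.card G : ℝ)⁻¹) := by
  classical
  have : Finite H := .of_surjective π hπ
  have := Fintype.ofFinite H
  have hcardG : Nat.card G = Nat.card H * Nat.card π.ker := by
    rw [← π.ker.card_mul_index, mul_comm, Subgroup.index_ker, π.range_eq_top.mpr hπ,
      Subgroup.card_top]
  have hH : (Nat.card H : ℂ) ≠ 0 := Nat.cast_ne_zero.mpr Nat.card_pos.ne'
  have hker : (Nat.card π.ker : ℂ) ≠ 0 := Nat.cast_ne_zero.mpr Nat.card_pos.ne'
  have hsum : ∑ a, centralSignedAugmentation G (centralFibreAverage ℂ hπ a) *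
      centralSignedAugmentation G (centralFibreAverage ℂ hπ a⁻¹) =
      (1 - 2 * (Nat.card π.ker : ℂ)⁻¹) ^ 2 + (Nat.card H - 1) := by
    simp only [centralSignedAugmentation_centralFibreAverage, inv_eq_one]
    rw [← Finset.add_sum_erase _ _ (Finset.mem_univ 1), Finset.sum_congr rfl (g := fun _ ↦ 1)
      fun a ha ↦ by simp [Finset.ne_of_mem_erase ha], Finset.sum_const, nsmul_one,
      Finset.cast_card_erase_of_mem (Finset.mem_univ 1), Finset.card_univ, if_pos rfl, sq,
      Fintype.card_eq_nat_card]
  apply Complex.ofReal_injective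
  rw [ofReal_AMZ_eq_of_isConj hπ hconj, hsum, centralSignedAugmentation_one_sub_centralFibreAverage,
    hcardG]
  push_cast
  field_simp
  ring

end CentralFibreAverage

section CharacterDegrees

variable {k G V W : Type*} [Field k] [Group G] [AddCommGroup V] [Module k V] [AddCommGroup W]
  [Module k W] {ρ : Representation k G V} {σ : Representation k G W}

open Representation

theorem isIrreducible_of_equiv (e : Equiv ρ σ) (hρ : ρ.IsIrreducible) : σ.IsIrreducible := by
  rw [irreducible_iff_isSimpleModule_asModule] at hρ ⊢
  exact .congr (LinearEquiv.ofBijective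
    (IntertwiningMap.equivLinearMapAsModule ρ σ e.toIntertwiningMap)
    (EquivLike.bijective e.toLinearEquiv)).symm

theorem finrank_le_card_of_isIrreducible [Finite G] (hρ : ρ.IsIrreducible) :
    Module.finrank k V ≤ Nat.card G := by
  have : Module.Finite k (MonoidAlgebra k G) := .of_basis (MonoidAlgebra.basis G k)
  have : IsSimpleModule (MonoidAlgebra k G) ρ.asModule :=
    ρ.irreducible_iff_isSimpleModule_asModule.mp hρ
  have := IsSimpleModule.nontrivial (MonoidAlgebra k G) ρ.asModule
  obtain ⟨v, hv⟩ := exists_ne (0 : ρ.asModule)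
  change Module.finrank k ρ.asModule ≤ _
  rw [← Module.finrank_eq_nat_card_basis (MonoidAlgebra.basis G k)]
  exact LinearMap.finrank_le_finrank_of_surjective
    (f := (LinearMap.toSpanSingleton (MonoidAlgebra k G) ρ.asModule v).restrictScalars k)
    (IsSimpleModule.toSpanSingleton_surjective _ hv)

theorem finrank_mem_charDegrees {V : Type*} [AddCommGroup V] [Module ℂ V] [FiniteDimensional ℂ V]
    {ρ : Representation ℂ G V} (hρ : ρ.IsIrreducible) : Module.finrank ℂ V ∈ charDegrees G := by
  let e : V ≃ₗ[ℂ] (Fin (Module.finrank ℂ V) → ℂ) := (Module.finBasis ℂ V).equivFun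
  let σ : Representation ℂ G (Fin (Module.finrank ℂ V) → ℂ) :=
    (e.conjRingEquiv : Module.End ℂ V →* _).comp ρ
  have hσ : σ.IsIrreducible := isIrreducible_of_equiv (.mk e fun g ↦ LinearMap.ext fun v ↦ by
    simp [σ]) hρ
  refine ⟨_, ⟨_, σ, hσ, rfl⟩, ?_⟩
  rw [char_one, Module.finrank_fin_fun]

theorem le_maxCharDegree [Finite G] {d : ℕ} (hd : d ∈ charDegrees G) : d ≤ maxCharDegree G := by
  refine le_csSup ⟨Nat.card G, ?_⟩ hd
  rintro d ⟨_, ⟨n, ρ, hρ, rfl⟩, hd⟩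
  rw [char_one, Nat.cast_inj] at hd
  exact hd ▸ finrank_le_card_of_isIrreducible hρ

end CharacterDegrees

namespace Aff

section CommRing

variable {K : Type*} [CommRing K]

/-- The linear part `a` of the affine transformation `x ↦ a x + b`. -/
noncomputable def linearPart (K : Type*) [CommRing K] : Aff K →* Kˣ :=
  Matrix.GeneralLinearGroup.det.comp (Aff K).subtype

/-- The translation part `b` of the affine transformation `x ↦ a x + b`. -/
def translationPart (g : Aff K) : K := (g : GL (Fin 2) K).1 0 1

/-- The affine transformation `x ↦ a x + b`. -/
noncomputable def mk (a : Kˣ) (b : K) : Aff K :=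
  ⟨Matrix.GeneralLinearGroup.mk'' !![(a : K), b; 0, 1] (by simp), a, b, rfl⟩

@[simp]
theorem linearPart_mk (a : Kˣ) (b : K) : linearPart K (mk a b) = a :=
  Units.ext (Matrix.det_fin_two_of _ _ _ _ |>.trans (by simp))

@[simp]
theorem translationPart_mk (a : Kˣ) (b : K) : translationPart (mk a b) = b := rfl

@[simp]
theorem mk_linearPart_translationPart (g : Aff K) :
    mk (linearPart K g) (translationPart g) = g := by
  obtain ⟨g, a, b, hg⟩ := g
  have ha : linearPart K ⟨g, a, b, hg⟩ = a := Units.ext <| by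
    simp [linearPart, hg]
  have hb : translationPart ⟨g, a, b, hg⟩ = b := by simp [translationPart, hg]
  exact Subtype.ext <| Units.ext <| by rw [ha, hb, hg]; rfl

theorem ext_parts {g h : Aff K} (hlin : linearPart K g = linearPart K h)
    (htrans : translationPart g = translationPart h) : g = h := by
  rw [← mk_linearPart_translationPart g, hlin, htrans, mk_linearPart_translationPart]

@[simp]
theorem translationPart_one : translationPart (1 : Aff K) = 0 := by
  simp [translationPart]

theorem translationPart_mul (g h : Aff K) : translationPart (g * h) =
    linearPart K g * translationPart h + translationPart g := by
  have hcoe (g : Aff K) :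
      (g : GL (Fin 2) K).1 = !![(linearPart K g : K), translationPart g; 0, 1] :=
    congrArg (fun x : Aff K ↦ (x : GL (Fin 2) K).1) (mk_linearPart_translationPart g).symm
  change ((g : GL (Fin 2) K).1 * (h : GL (Fin 2) K).1) 0 1 = _
  simp [hcoe]

theorem linearPart_surjective : Function.Surjective (linearPart K) :=
  fun a ↦ ⟨mk a 0, linearPart_mk a 0⟩

theorem card_ker_linearPart : Nat.card (linearPart K).ker = Nat.card K :=
  Nat.card_congr
    { toFun := fun g ↦ translationPart g.1
      invFun := fun b ↦ ⟨mk 1 b, linearPart_mk 1 b⟩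
      left_inv := fun g ↦ Subtype.ext <|
        ext_parts ((linearPart_mk 1 _).trans (MonoidHom.mem_ker.mp g.2).symm) rfl
      right_inv := translationPart_mk 1 }

theorem isConj_of_mul_translationPart_add_eq {g h : Aff K} (hgh : linearPart K g = linearPart K h)
    (a : Kˣ) (b : K)
    (hab : a * translationPart g + b = linearPart K h * b + translationPart h) : IsConj g h := by
  refine isConj_iff.mpr ⟨mk a b, mul_inv_eq_iff_eq_mul.mpr (ext_parts ?_ ?_)⟩
  · rw [map_mul, map_mul, hgh, mul_comm]
  · simpa only [translationPart_mul, linearPart_mk, translationPart_mk] using hab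

theorem exists_mul_ne_mul [Nontrivial Kˣ] : ∃ x y : Aff K, x * y ≠ y * x := by
  obtain ⟨a, ha⟩ := exists_ne (1 : Kˣ)
  refine ⟨mk a 0, mk 1 1, fun h ↦ ha (Units.ext ?_)⟩
  simpa [translationPart_mul] using congrArg translationPart h

/-- The Kirillov model: the representation of the affine group on functions on the units in which
scalings act by multiplicative translation and translations by multiplication with the additive
character `ψ`. -/
noncomputable def kirillovRepresentation {k : Type*} [CommSemiring k] (ψ : AddChar K k) :
    Representation k (Aff K) (Kˣ → k) where
  toFun g :=
    { toFun f x := ψ (translationPart g * x) * f (x * linearPart K g)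
      map_add' f f' := by ext; simp [mul_add]
      map_smul' c f := by ext; simp [mul_left_comm] }
  map_one' := by ext; simp
  map_mul' g h := by
    refine LinearMap.ext fun f ↦ funext fun x ↦ ?_
    simp only [LinearMap.coe_mk, AddHom.coe_mk, Module.End.mul_apply, translationPart_mul,
      map_mul, Units.val_mul, ← mul_assoc, ← AddChar.map_add_eq_mul]
    congr 2
    ring

theorem kirillovRepresentation_apply {k : Type*} [CommSemiring k] (ψ : AddChar K k) (g : Aff K)
    (f : Kˣ → k) (x : Kˣ) : kirillovRepresentation ψ g f x =
      ψ (translationPart g * x) * f (x * linearPart K g) := rfl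

theorem kirillovRepresentation_mk_zero_single {k : Type*} [CommSemiring k] [DecidableEq Kˣ]
    (ψ : AddChar K k) (a x : Kˣ) :
    kirillovRepresentation ψ (mk a 0) (Pi.single x 1) = Pi.single (x * a⁻¹) 1 := by
  ext y
  simp [kirillovRepresentation_apply, Pi.single_apply, eq_mul_inv_iff_mul_eq]

theorem sum_smul_kirillovRepresentation {k : Type*} [CommRing k] [IsDomain k] [Fintype K]
    [DecidableEq Kˣ] {ψ : AddChar K k} (hψ : ψ.IsPrimitive) (f : Kˣ → k) (x : Kˣ) :
    ∑ b, ψ (-(b * x)) • kirillovRepresentation ψ (mk 1 b) f =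
      (Fintype.card K * f x) • Pi.single x 1 := by
  classical
  ext y
  have hterm (b : K) : (ψ (-(b * x)) • kirillovRepresentation ψ (mk 1 b) f) y =
      ψ (b * (y - x)) * f y := by
    rw [Pi.smul_apply, kirillovRepresentation_apply, smul_eq_mul, ← mul_assoc,
      ← AddChar.map_add_eq_mul, linearPart_mk, translationPart_mk, mul_one, neg_add_eq_sub, mul_sub]
  rw [Finset.sum_apply, Finset.sum_congr rfl fun b _ ↦ hterm b, ← Finset.sum_mul,
    AddChar.sum_mulShift _ hψ]
  obtain rfl | hxy := eq_or_ne y x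
  · simp
  · simp [hxy, sub_eq_zero, Units.val_inj]

theorem isIrreducible_kirillovRepresentation {k : Type*} [Field k] [CharZero k] [Finite K]
    {ψ : AddChar K k} (hψ : ψ.IsPrimitive) : (kirillovRepresentation ψ).IsIrreducible := by
  classical
  have := Fintype.ofFinite K
  have hsingle {S : Subrepresentation (kirillovRepresentation ψ)} {f : Kˣ → k}
      (hf : f ∈ S.toSubmodule) {x : Kˣ} (hx : f x ≠ 0) : Pi.single x 1 ∈ S.toSubmodule := by
    have hcard : (Fintype.card K : k) ≠ 0 := Nat.cast_ne_zero.mpr Fintype.card_ne_zero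
    rw [← Submodule.smul_mem_iff _ (mul_ne_zero hcard hx), ← sum_smul_kirillovRepresentation hψ]
    exact sum_mem fun b _ ↦ Submodule.smul_mem _ _ (S.apply_mem_toSubmodule _ hf)
  have : Nontrivial (Subrepresentation (kirillovRepresentation ψ)) :=
    ⟨⊥, ⊤, fun h ↦ bot_ne_top (congrArg Subrepresentation.toSubmodule h)⟩
  refine { eq_bot_or_eq_top := fun S ↦ or_iff_not_imp_left.mpr fun hS ↦ ?_ }
  obtain ⟨f, hf, hf0⟩ := (Submodule.ne_bot_iff _).mp
    fun h ↦ hS (Subrepresentation.toSubmodule_injective h)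
  obtain ⟨x, hx⟩ := Function.ne_iff.mp hf0
  have hall (y : Kˣ) : Pi.single y 1 ∈ S.toSubmodule := by
    have := S.apply_mem_toSubmodule (mk (y⁻¹ * x) 0) (hsingle hf hx)
    rwa [kirillovRepresentation_mk_zero_single, mul_inv_rev, inv_inv, mul_inv_cancel_left] at this
  refine Subrepresentation.toSubmodule_injective (Submodule.eq_top_iff'.mpr fun f ↦ ?_)
  rw [pi_eq_sum_univ' f]
  exact sum_mem fun y _ ↦ Submodule.smul_mem _ _ (by convert hall y using 1)

end CommRing

section Field

variable {F : Type*} [Field F]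

theorem isConj_of_linearPart_eq {g h : Aff F} (hgh : linearPart F g = linearPart F h)
    (hg : g ≠ 1) (hh : h ≠ 1) : IsConj g h := by
  by_cases hlin : linearPart F h = 1
  · have htrans {g : Aff F} (hg : g ≠ 1) (hlin : linearPart F g = 1) : translationPart g ≠ 0 :=
      fun h ↦ hg (ext_parts (by rw [hlin, map_one]) (by rw [h, translationPart_one]))
    have hg' := htrans hg (hgh.trans hlin)
    exact isConj_of_mul_translationPart_add_eq hgh
      (Units.mk0 (translationPart h / translationPart g) (div_ne_zero (htrans hh hlin) hg')) 0
      (by simp [hg'])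
  · have hsub : (1 : F) - linearPart F h ≠ 0 :=
      sub_ne_zero.mpr fun h ↦ hlin (Units.ext h.symm)
    refine isConj_of_mul_translationPart_add_eq hgh 1
      ((translationPart h - translationPart g) / (1 - linearPart F h)) ?_
    rw [Units.val_one]
    field_simp
    ring

variable [Finite F]

theorem AMZ_eq : AMZ (Aff F) = 5 - 8 / (Nat.card F : ℝ) := by
  have : Nontrivial (linearPart F).ker := by
    rw [← Finite.one_lt_card_iff_nontrivial, card_ker_linearPart]
    exact Finite.one_lt_card
  have hcard : (Nat.card (Aff F) : ℝ) = (Nat.card F - 1) * Nat.card F := by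
    rw [← (linearPart F).ker.card_mul_index, Subgroup.index_ker,
      (linearPart F).range_eq_top.mpr linearPart_surjective, Subgroup.card_top,
      card_ker_linearPart, Nat.card_units, Nat.cast_mul, Nat.cast_sub Finite.one_lt_card.le,
      Nat.cast_one, mul_comm]
  have hq : (1 : ℝ) < Nat.card F := Nat.one_lt_cast.mpr Finite.one_lt_card
  have hq0 : (Nat.card F : ℝ) ≠ 0 := by linarith
  have hq1 : (Nat.card F : ℝ) - 1 ≠ 0 := by linarith
  rw [AMZ_eq_of_isConj linearPart_surjective fun _ _ ↦ isConj_of_linearPart_eq,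
    card_ker_linearPart, hcard]
  field_simp
  ring

theorem card_sub_one_mem_charDegrees : Nat.card F - 1 ∈ charDegrees (Aff F) := by
  have := Fintype.ofFinite Fˣ
  obtain ⟨ψ, hψ⟩ := AddChar.exists_apply_ne_zero.mpr (one_ne_zero : (1 : F) ≠ 0)
  have hprim : ψ.IsPrimitive := .of_ne_one fun h ↦ hψ (by rw [h, AddChar.one_apply])
  have hdeg := finrank_mem_charDegrees (isIrreducible_kirillovRepresentation hprim)
  rwa [Module.finrank_fintype_fun_eq_card, ← Nat.card_eq_fintype_card, Nat.card_units] at hdeg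

theorem AMZ_le_five : AMZ (Aff F) ≤ 5 :=
  AMZ_eq.trans_le (sub_le_self _ (by positivity))

theorem two_le_AMZ (hF : 3 ≤ Nat.card F) : 2 ≤ AMZ (Aff F) := by
  have hF' : (3 : ℝ) ≤ Nat.card F := by exact_mod_cast hF
  have : 8 / (Nat.card F : ℝ) ≤ 8 / 3 := by gcongr
  rw [AMZ_eq]
  linarith

theorem exists_mul_ne_mul_of_three_le_card (hF : 3 ≤ Nat.card F) :
    ∃ x y : Aff F, x * y ≠ y * x := by
  have : Nontrivial Fˣ := by
    rw [← Finite.one_lt_card_iff_nontrivial, Nat.card_units]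
    omega
  exact exists_mul_ne_mul

end Field

end Aff

theorem exists_seq_le_maxCharDegree_isLUB_AMZ :
    ∃ (G : ℕ → Type) (_ : ∀ i, Group (G i)) (_ : ∀ i, Finite (G i)),
      (∀ i, ∃ x y : G i, x * y ≠ y * x) ∧ (∀ i, i ≤ maxCharDegree (G i)) ∧
      IsLUB (Set.range fun i ↦ AMZ (G i)) 5 := by
  have hcard (i : ℕ) : Nat.card (GaloisField 2 (i + 2)) = 2 ^ (i + 2) :=
    GaloisField.card 2 (i + 2) (by omega)
  have hlt (i : ℕ) : i + 2 < 2 ^ (i + 2) := Nat.lt_two_pow_self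
  refine ⟨fun i ↦ Aff (GaloisField 2 (i + 2)), fun _ ↦ inferInstance, fun _ ↦ inferInstance,
    fun i ↦ Aff.exists_mul_ne_mul_of_three_le_card ?_, fun i ↦ ?_, ?_⟩
  · rw [hcard]
    exact Nat.succ_le_of_lt ((Nat.le_add_left 2 i).trans_lt (hlt i))
  · refine le_trans ?_ (le_maxCharDegree Aff.card_sub_one_mem_charDegrees)
    rw [hcard]
    have := hlt i
    omega
  · simp only [Aff.AMZ_eq, hcard, Nat.cast_pow, Nat.cast_ofNat]
    refine isLUB_of_tendsto_atTop (fun i j hij ↦ ?_) ?_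
    · gcongr
      norm_num
    · have hpow : Filter.Tendsto (fun i : ℕ ↦ (2 : ℝ) ^ (i + 2)) Filter.atTop Filter.atTop :=
        (tendsto_pow_atTop_atTop_of_one_lt one_lt_two).comp (Filter.tendsto_add_atTop_nat 2)
      simpa using (hpow.const_div_atTop 8).const_sub 5

theorem mainTheorem7_general.{u} :
    (∀ (F : Type u) [Field F] [Finite F], AMZ (Aff F) = 5 - 8 / (Nat.card F : ℝ)) ∧
    (∀ (F : Type u) [Field F] [Finite F], 3 ≤ Nat.card F →
      2 ≤ AMZ (Aff F) ∧ AMZ (Aff F) ≤ 5 ∧ Nat.card F - 1 ∈ charDegrees (Aff F)) ∧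
    (∃ (G : ℕ → Type) (_ : ∀ i, Group (G i)) (_ : ∀ i, Finite (G i)),
      (∀ i, ∃ x y : G i, x * y ≠ y * x) ∧ (∀ N : ℕ, ∃ i, N ≤ maxCharDegree (G i)) ∧
      IsLUB (Set.range fun i ↦ AMZ (G i)) 5) ∧
    (¬ ∃ f : ℕ → ℝ, Filter.Tendsto f Filter.atTop Filter.atTop ∧
      ∀ (G : Type) [Group G] [Finite G], (∃ x y : G, x * y ≠ y * x) →
        f (maxCharDegree G) ≤ AMZ G) := by
  obtain ⟨G, hGroup, hFinite, hcomm, hdeg, hlub⟩ := exists_seq_le_maxCharDegree_isLUB_AMZ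
  refine ⟨fun F _ _ ↦ Aff.AMZ_eq, fun F _ _ hF ↦ ⟨Aff.two_le_AMZ hF, Aff.AMZ_le_five,
    Aff.card_sub_one_mem_charDegrees⟩, ⟨G, hGroup, hFinite, hcomm, fun N ↦ ⟨N, hdeg N⟩, hlub⟩, ?_⟩
  rintro ⟨f, hf, hbound⟩
  have hdegTop : Filter.Tendsto (fun i ↦ maxCharDegree (G i)) Filter.atTop Filter.atTop :=
    Filter.tendsto_atTop_mono hdeg Filter.tendsto_id
  obtain ⟨i, hi⟩ := ((hf.comp hdegTop).eventually_gt_atTop 5).exists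
  exact hi.not_ge ((hbound (G i) (hcomm i)).trans (hlub.1 ⟨i, rfl⟩))

theorem mainTheorem7 :
    -- the exact value for finite fields with at least three elements
    (∀ (F : Type*) [Field F] [Finite F], 3 ≤ Nat.card F →
      AMZ (Aff F) = 5 - 8 / (Nat.card F : ℝ)) ∧
    -- bounds and the degree `p - 1` for odd primes `p`
    (∀ p : ℕ, ∀ [Fact p.Prime], Odd p →
      2 ≤ AMZ (Aff (ZMod p)) ∧ AMZ (Aff (ZMod p)) ≤ 5 ∧ p - 1 ∈ charDegrees (Aff (ZMod p))) ∧
    -- a sequence of finite non-abelian groups with maximal character degrees unbounded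
    -- and supremum of the amenability constants equal to 5
    (∃ (G : ℕ → Type) (_ : ∀ i, Group (G i)) (_ : ∀ i, Finite (G i)),
      (∀ i, ∃ x y : G i, x * y ≠ y * x) ∧
      (∀ N : ℕ, ∃ i, N ≤ maxCharDegree (G i)) ∧
      IsLUB (Set.range fun i => AMZ (G i)) 5) ∧
    -- no increasing unbounded function of the maximal degree is a lower bound
    (¬ ∃ f : ℕ → ℝ, Monotone f ∧ Filter.Tendsto f Filter.atTop Filter.atTop ∧
      ∀ (G : Type) [Group G] [Finite G], (∃ x y : G, x * y ≠ y * x) →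
        f (maxCharDegree G) ≤ AMZ G) := by
  refine ⟨fun F _ _ _ ↦ mainTheorem7_general.1 F, fun p _ hp ↦ ?_, mainTheorem7_general.{0}.2.2.1,
    fun ⟨f, _, hf⟩ ↦ mainTheorem7_general.{0}.2.2.2 ⟨f, hf⟩⟩
  simpa only [Nat.card_zmod] using mainTheorem7_general.{0}.2.1 (ZMod p)
    (by rwa [Nat.card_zmod, ← (Fact.out : p.Prime).odd_iff])
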